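/- Let $\mathbb K$ be a field of characteristic $0$; all vector spaces and algebras are over $\mathbb K$, and algebras are not required to have a unit. An involution on a vector space $V$ is a linear map $v\mapsto v^*$ with $v^{**}=v$. A nonunitary involutive Rota-Baxter algebra is an associative algebra $A$ with an involution satisfying $(ab)^*=b^*a^*$ and a linear map $R:A\to A$ satisfying $R(a^*)=R(a)^*$ and $R(a)R(b)=R(aR(b)+R(a)b)$; morphisms are the algebra maps that commute with the involutions and the operators $R$. Let $B$ be an algebra with basis $X$. Rota-Baxter words on $X$ are the nonempty finite words $\mathbf x=\mathbf x_1\cdots\mathbf x_k$ whose components $\mathbf x_i$ are alternately letters of $X$ and brackets $\lfloor \mathbf u\rfloor$ of Rota-Baxter words $\mathbf u$. Let $\varpi^{\mathrm{NC},0}(B)$ be the vector space with basis the Rota-Baxter words on $X$, with the bilinear product $$\mathbf x_1\cdots\mathbf x_k\diamond \mathbf y_1\cdots\mathbf y_l=\mathbf x_1\cdots\mathbf x_{k-1}(\mathbf x_k\diamond \mathbf y_1)\mathbf y_2\cdots \mathbf y_l,$$ where $\mathbf x_k\diamond\mathbf y_1$ is the product in $B$ (expanded in the basis $X$) if both are letters,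 the concatenation if exactly one of them is a letter, and, recursively, $\lfloor \mathbf u\rfloor\diamond\lfloor \mathbf v\rfloor=\lfloor\lfloor \mathbf u\rfloor\diamond \mathbf v\rfloor+\lfloor \mathbf u\diamond\lfloor \mathbf v\rfloor\rfloor$. Let $R_B$ be the linear map with $R_B(\mathbf x)=\lfloor \mathbf x\rfloor$, and $j_B:B\to\varpi^{\mathrm{NC},0}(B)$ the linear map that sends each $x\in X$ to the one-letter word $x$. If $B$ carries an involution with $(ab)^*=b^*a^*$, define a linear map $*$ on $\varpi^{\mathrm{NC},0}(B)$ by $x^*=j_B(x^*)$ for $x\in X$, $\lfloor \mathbf u\rfloor^*=\lfloor \mathbf u^*\rfloor$ and $(\mathbf x_1\cdots\mathbf x_k)^*=\mathbf x_k^*\cdots\mathbf x_1^*$ (extended multilinearly). Let $V$ be a vector space with an involution, let $T(V)=\bigoplus_{n\ge1}V^{\otimes n}$ with the involution $(v_1\otimes\cdots\otimes v_n)^*=v_n^*\otimes\cdots\otimes v_1^*$, let $i:V\to T(V)$ be the inclusion, and let $X$ be any basis of $T(V)$. Then $\varpi^{\mathrm{NC},0}(T(V))$, with $\diamond$, $*$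 and $R_{T(V)}$, is a nonunitary involutive Rota-Baxter algebra, the map $j_{T(V)}\circ i$ preserves the involutions, and for every nonunitary involutive Rota-Baxter algebra $A$ and every linear map $f:V\to A$ preserving the involutions there is a unique morphism of nonunitary involutive Rota-Baxter algebras $\widetilde f:\varpi^{\mathrm{NC},0}(T(V))\to A$ with $\widetilde f\circ(j_{T(V)}\circ i)=f$. -/

import Mathlib

universe u v w

noncomputable section

namespace RotaBaxter

/-! ### Involutive Rota-Baxter algebras (of weight zero, nonunitary) -/

section Algebras

variable {K : Type*} [Field K]

/-- `star` and `R` make the (not necessarily unital) `K`-algebra `A` an involutive Rota-Baxter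
algebra. The associativity of `A` is one of the conditions, so that the predicate can be asserted
about a product which is not yet known to be associative. -/
structure IsInvolutiveRotaBaxter {A : Type*} [NonUnitalNonAssocRing A] [Module K A]
    [IsScalarTower K A A] [SMulCommClass K A A] (star R : A →ₗ[K] A) : Prop where
  mul_assoc : ∀ a b c : A, a * b * c = a * (b * c)
  star_star : ∀ a : A, star (star a) = a
  star_mul : ∀ a b : A, star (a * b) = star b * star a
  rota_baxter : ∀ a b : A, R a * R b = R (a * R b + R a * b)
  map_star : ∀ a : A, R (star a) = star (R a)

/-- Morphisms of involutive Rota-Baxter algebras: algebra maps (not required to respect any unit)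
that commute with the involutions and with the Rota-Baxter operators. -/
structure IsInvolutiveRotaBaxterHom {A A' : Type*}
    [NonUnitalNonAssocRing A] [Module K A] [NonUnitalNonAssocRing A'] [Module K A']
    (star R : A →ₗ[K] A) (star' R' : A' →ₗ[K] A') (φ : A →ₙₐ[K] A') : Prop where
  map_star : ∀ a : A, φ (star a) = star' (φ a)
  map_operator : ∀ a : A, φ (R a) = R' (φ a)

end Algebras

/-! ### Rota-Baxter words -/

/-- Rota-Baxter words on the alphabet `X`, graded by their head: `false` if the word begins with a
letter of `X`, and `true` if it begins with a bracket `⌊u⌋`. A word is a nonempty sequence in which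
letters and brackets `⌊u⌋` of Rota-Baxter words `u` alternate, so that prefixing a letter
requires a word which begins with a bracket and conversely. -/
inductive RBWord (X : Type u) : Bool → Type u
  /-- the word `x` -/
  | letter (x : X) : RBWord X false
  /-- the word `⌊u⌋` -/
  | bracket {h : Bool} (u : RBWord X h) : RBWord X true
  /-- the concatenation `x w`, where `w` begins with a bracket -/
  | letterCons (x : X) (w : RBWord X true) : RBWord X false
  /-- the concatenation `⌊u⌋ w`, where `w` begins with a letter -/
  | bracketCons {h : Bool} (u : RBWord X h) (w : RBWord X false) : RBWord X true

/-! ### The algebra of Rota-Baxter words on a basis of an algebra -/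

section WordAlgebra

variable {K : Type v} [Field K] {B : Type w} [NonUnitalRing B] [Module K B] {X : Type u}

/-- The product of two Rota-Baxter words on a basis `b` of the algebra `B`. All but the last
component of the left factor are kept in front; the last component `x` or `⌊u⌋` of the left factor is
multiplied with the first component of the right factor, and the rest of the right factor is kept.
Two letters are multiplied in `B`, a letter and a bracket are concatenated, and
`⌊u⌋ ⌊v⌋ = ⌊⌊u⌋ v⌋ + ⌊u ⌊v⌋⌋`. All words occurring in the product have the same head as the left
factor. -/
def mulWord (b : Module.Basis X K B) :
    {h h' : Bool} → RBWord X h → RBWord X h' → (RBWord X h →₀ K)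
  | _, _, .letterCons x w, y => (mulWord b w y).mapDomain (.letterCons x)
  | _, _, .bracketCons u w, y => (mulWord b w y).mapDomain (.bracketCons u)
  | _, _, .letter x, .letter y => (b.repr (b x * b y)).mapDomain .letter
  | _, _, .letter x, .letterCons y w' => (b.repr (b x * b y)).mapDomain fun z => .letterCons z w'
  | _, _, .letter x, .bracket v => .single (.letterCons x (.bracket v)) 1
  | _, _, .letter x, .bracketCons v w' => .single (.letterCons x (.bracketCons v w')) 1
  | _, _, .bracket u, .letter y => .single (.bracketCons u (.letter y)) 1
  | _, _, .bracket u, .letterCons y w' => .single (.bracketCons u (.letterCons y w')) 1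
  | _, _, .bracket u, .bracket v =>
      (mulWord b (.bracket u) v).mapDomain .bracket +
        (mulWord b u (.bracket v)).mapDomain .bracket
  | _, _, .bracket u, .bracketCons v w' =>
      (mulWord b (.bracket u) v).mapDomain (fun z => .bracketCons z w') +
        (mulWord b u (.bracket v)).mapDomain (fun z => .bracketCons z w')
  termination_by _ _ x y => sizeOf x + sizeOf y

/-- The vector space `ϖ^{NC,0}(B)` with basis the Rota-Baxter words on the basis `b` of `B`. -/
@[nolint unusedArguments]
def RBWordAlgebra (_b : Module.Basis X K B) : Type (max u v) := (Σ h : Bool, RBWord X h) →₀ K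

namespace RBWordAlgebra

variable (b : Module.Basis X K B)

instance : AddCommGroup (RBWordAlgebra b) :=
  inferInstanceAs (AddCommGroup ((Σ h : Bool, RBWord X h) →₀ K))

instance : Module K (RBWordAlgebra b) :=
  inferInstanceAs (Module K ((Σ h : Bool, RBWord X h) →₀ K))

/-- The Rota-Baxter words, as a basis. -/
def wordBasis : Module.Basis (Σ h : Bool, RBWord X h) K (RBWordAlgebra b) :=
  Finsupp.basisSingleOne

/-- The bilinear extension of the product of Rota-Baxter words. -/
def mulLin : RBWordAlgebra b →ₗ[K] RBWordAlgebra b →ₗ[K] RBWordAlgebra b :=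
  (wordBasis b).constr K fun x => (wordBasis b).constr K fun y =>
    Finsupp.linearCombination K (fun z => wordBasis b ⟨x.1, z⟩) (mulWord b x.2 y.2)

instance : Mul (RBWordAlgebra b) := ⟨fun x y => mulLin b x y⟩

variable {b} in
theorem mul_def (x y : RBWordAlgebra b) : x * y = mulLin b x y := rfl

instance : NonUnitalNonAssocRing (RBWordAlgebra b) where
  left_distrib x y z := by simp [mul_def]
  right_distrib x y z := by simp [mul_def]
  zero_mul x := by simp [mul_def]
  mul_zero x := by simp [mul_def]

instance : IsScalarTower K (RBWordAlgebra b) (RBWordAlgebra b) :=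
  ⟨fun c x y => by simp [mul_def, smul_eq_mul]⟩

instance : SMulCommClass K (RBWordAlgebra b) (RBWordAlgebra b) :=
  ⟨fun c x y => by simp [mul_def, smul_eq_mul]⟩

/-- The operator `R_B`, sending a word `x` to `⌊x⌋`. -/
def operator : RBWordAlgebra b →ₗ[K] RBWordAlgebra b :=
  (wordBasis b).constr K fun x => wordBasis b ⟨true, .bracket x.2⟩

/-- The map `j_B : B → ϖ^{NC,0}(B)`, the linear extension of the inclusion of the letters. -/
def incl : B →ₗ[K] RBWordAlgebra b :=
  b.constr K fun x => wordBasis b ⟨false, .letter x⟩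

/-- The involution on words induced by a linear map `σ` on `B`: letters are sent to their image
in `B`, `⌊u⌋* = ⌊u*⌋`, and `(x₁ ⋯ xₙ)* = xₙ* ⋯ x₁*`. The factors on the right are combinations of
letters and of brackets in alternation, so their product is the multilinear concatenation. -/
def starWord (σ : B →ₗ[K] B) : {h : Bool} → RBWord X h → RBWordAlgebra b
  | _, .letter x => incl b (σ (b x))
  | _, .bracket u => operator b (starWord σ u)
  | _, .letterCons x w => starWord σ w * incl b (σ (b x))
  | _, .bracketCons u w => starWord σ w * operator b (starWord σ u)

/-- The involution on `ϖ^{NC,0}(B)` induced by the involution `σ` on `B`. -/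
def star (σ : B →ₗ[K] B) : RBWordAlgebra b →ₗ[K] RBWordAlgebra b :=
  (wordBasis b).constr K fun x => starWord b σ x.2

end RBWordAlgebra

end WordAlgebra

/-! ### The nonunitary tensor algebra -/

section Tensor

variable (K : Type u) [Field K] (V : Type v) [AddCommGroup V] [Module K V]

/-- The nonunitary tensor algebra `⊕_{n ≥ 1} V^{⊗ n}`, as the sum of the components of degree
`n ≥ 1` in the tensor algebra `⊕_{n ≥ 0} V^{⊗ n}`. -/
def tensorPos : NonUnitalSubalgebra K (TensorAlgebra K V) :=
  (⨆ n : ℕ, LinearMap.range (TensorAlgebra.ι K (M := V)) ^ (n + 1)).toNonUnitalSubalgebra (by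
    intro x y hx hy
    refine SetLike.le_def.1 ?_ (Submodule.mul_mem_mul hx hy)
    rw [Submodule.iSup_mul]
    refine iSup_le fun m => ?_
    rw [Submodule.mul_iSup]
    refine iSup_le fun n => ?_
    rw [← pow_add]
    exact le_iSup_of_le (m + 1 + n) (le_of_eq (by congr 1)))

variable {K V}

theorem mem_tensorPos {x : TensorAlgebra K V} : x ∈ tensorPos K V ↔
    x ∈ ⨆ n : ℕ, LinearMap.range (TensorAlgebra.ι K (M := V)) ^ (n + 1) := Iff.rfl

theorem ι_mem_tensorPos (v : V) : TensorAlgebra.ι K v ∈ tensorPos K V :=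
  mem_tensorPos.2 (Submodule.mem_iSup_of_mem 0 (by simp))

variable (K) in
/-- The inclusion `i : V → T(V)`. -/
def tensorIncl : V →ₗ[K] tensorPos K V :=
  (TensorAlgebra.ι K).codRestrict (tensorPos K V).toSubmodule ι_mem_tensorPos

/-- The linear map of the tensor algebra with `v₁ ⊗ ⋯ ⊗ vₙ ↦ σ vₙ ⊗ ⋯ ⊗ σ v₁`. -/
def tensorReverse (σ : V →ₗ[K] V) : TensorAlgebra K V →ₗ[K] TensorAlgebra K V :=
  (MulOpposite.opLinearEquiv K).symm.toLinearMap ∘ₗ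
    (TensorAlgebra.lift K
      ((MulOpposite.opLinearEquiv K).toLinearMap ∘ₗ TensorAlgebra.ι K ∘ₗ σ)).toLinearMap

theorem tensorReverse_ι (σ : V →ₗ[K] V) (v : V) :
    tensorReverse σ (TensorAlgebra.ι K v) = TensorAlgebra.ι K (σ v) := by
  simp [tensorReverse]

theorem tensorReverse_mul (σ : V →ₗ[K] V) (x y : TensorAlgebra K V) :
    tensorReverse σ (x * y) = tensorReverse σ y * tensorReverse σ x := by
  simp [tensorReverse]

theorem tensorReverse_mem (σ : V →ₗ[K] V) (x : TensorAlgebra K V) (hx : x ∈ tensorPos K V) :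
    tensorReverse σ x ∈ tensorPos K V := by
  rw [mem_tensorPos] at hx
  have key : (⨆ n : ℕ, LinearMap.range (TensorAlgebra.ι K (M := V)) ^ (n + 1)) ≤
      (tensorPos K V).toSubmodule.comap (tensorReverse σ) := by
    refine iSup_le fun n => ?_
    induction n with
    | zero =>
      rw [zero_add, pow_one]
      rintro _ ⟨v, rfl⟩
      rw [Submodule.mem_comap, tensorReverse_ι]
      exact ι_mem_tensorPos _
    | succ n ih =>
      rw [pow_succ, Submodule.mul_le]
      rintro y hy _ ⟨v, rfl⟩
      rw [Submodule.mem_comap, tensorReverse_mul, tensorReverse_ι]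
      exact (tensorPos K V).mul_mem (ι_mem_tensorPos _) (ih hy)
  exact key hx

/-- The involution on `T(V)` induced by an involution `σ` of `V`, with
`(v₁ ⊗ ⋯ ⊗ vₙ)* = vₙ* ⊗ ⋯ ⊗ v₁*`. -/
def tensorStar (σ : V →ₗ[K] V) : tensorPos K V →ₗ[K] tensorPos K V :=
  (tensorReverse σ).restrict (p := (tensorPos K V).toSubmodule)
    (q := (tensorPos K V).toSubmodule) (tensorReverse_mem σ)

end Tensor

end RotaBaxter

end

/-!
A word is a product of components, letters and brackets with alternating heads, and the products
of a component with a word of the other head are concatenations. Hence associativity reduces to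
triples of components with the same head: three letters, which multiply in `B`, or three brackets,
where the Rota-Baxter identity reduces the claim to triples in which one bracket has been opened.
The same reduction to pairs of components shows that the obvious extension of an algebra map on `B`
to words is multiplicative whenever the target operator is Rota-Baxter. As the identity
`R(a)R(b) = R(aR(b) + R(a)b)` is symmetric under reversal of products, this applies to the opposite
of the word algebra, where the extension of `σ` is the involution. The letters generate the word
algebra under products and brackets, so all maps are determined on `B`, and `T(V)` is free on `V`.
-/

noncomputable section

namespace RotaBaxter

section Span

variable {R A A' : Type*} [CommSemiring R] [NonUnitalNonAssocSemiring A] [Module R A]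
  [IsScalarTower R A A] [SMulCommClass R A A]

theorem mul_assoc_of_mem_span {S T U : Set A}
    (h : ∀ x ∈ S, ∀ y ∈ T, ∀ z ∈ U, x * y * z = x * (y * z)) {x y z : A}
    (hx : x ∈ Submodule.span R S) (hy : y ∈ Submodule.span R T) (hz : z ∈ Submodule.span R U) :
    x * y * z = x * (y * z) := by
  have linear_right {x y : A} (hx : x ∈ S) (hy : y ∈ T) : x * y * z = x * (y * z) :=
    LinearMap.eqOn_span (f := LinearMap.mulLeft R (x * y))
      (g := LinearMap.mulLeft R x ∘ₗ LinearMap.mulLeft R y) (h x hx y hy) hz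
  have linear_middle {x : A} (hx : x ∈ S) : x * y * z = x * (y * z) :=
    LinearMap.eqOn_span (f := LinearMap.mulRight R z ∘ₗ LinearMap.mulLeft R x)
      (g := LinearMap.mulLeft R x ∘ₗ LinearMap.mulRight R z) (fun _ => linear_right hx) hy
  exact LinearMap.eqOn_span (f := LinearMap.mulRight R z ∘ₗ LinearMap.mulRight R y)
    (g := LinearMap.mulRight R (y * z)) (fun _ => linear_middle) hx

theorem map_mul_of_mem_span [NonUnitalNonAssocSemiring A'] [Module R A'] [IsScalarTower R A' A']
    [SMulCommClass R A' A'] (F : A →ₗ[R] A') {S T : Set A}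
    (h : ∀ x ∈ S, ∀ y ∈ T, F (x * y) = F x * F y) {x y : A}
    (hx : x ∈ Submodule.span R S) (hy : y ∈ Submodule.span R T) : F (x * y) = F x * F y := by
  have linear_right {x : A} (hx : x ∈ S) : F (x * y) = F x * F y :=
    LinearMap.eqOn_span (f := F ∘ₗ LinearMap.mulLeft R x)
      (g := LinearMap.mulLeft R (F x) ∘ₗ F) (h x hx) hy
  exact LinearMap.eqOn_span (f := F ∘ₗ LinearMap.mulRight R y)
    (g := LinearMap.mulRight R (F y) ∘ₗ F) (fun _ => linear_right) hx

theorem mul_mem_of_mem_span {P : Submodule R A} {S T : Set A}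
    (h : ∀ x ∈ S, ∀ y ∈ T, x * y ∈ P) {x y : A}
    (hx : x ∈ Submodule.span R S) (hy : y ∈ Submodule.span R T) : x * y ∈ P :=
  LinearMap.BilinMap.apply_apply_mem_of_mem_span P S T (LinearMap.mul R A) h x y hx hy

end Span

/-- Rota-Baxter operators of weight zero on a not necessarily associative ring. -/
def IsRotaBaxterOperator {A : Type*} [NonUnitalNonAssocSemiring A] (P : A → A) : Prop :=
  ∀ x y : A, P x * P y = P (x * P y + P x * y)

namespace IsRotaBaxterOperator

theorem mul_mul_assoc {A : Type*} [NonUnitalNonAssocSemiring A] {P : A → A}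
    (hP : IsRotaBaxterOperator P) {x y z : A}
    (hx : x * P y * P z = x * (P y * P z)) (hy : P x * y * P z = P x * (y * P z))
    (hz : P x * P y * z = P x * (P y * z)) : P x * P y * P z = P x * (P y * P z) :=
  calc P x * P y * P z = P (x * P y + P x * y) * P z := by rw [hP x y]
    _ = P (x * P y * P z + P x * y * P z + P x * P y * z) := by
      rw [hP _ z, ← hP x y, add_mul]
    _ = P (x * (P y * P z) + P x * (y * P z + P y * z)) := by
      rw [hx, hy, hz, mul_add, add_assoc]
    _ = P x * (P y * P z) := by rw [hP y z, ← hP x]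

theorem of_span_eq_top {R A : Type*} [CommSemiring R] [NonUnitalNonAssocSemiring A] [Module R A]
    [IsScalarTower R A A] [SMulCommClass R A A] {P : A →ₗ[R] A} {S : Set A}
    (hS : Submodule.span R S = ⊤)
    (h : ∀ x ∈ S, ∀ y ∈ S, P x * P y = P (x * P y + P x * y)) : IsRotaBaxterOperator P := by
  intro x y
  have linear_right {x : A} (hx : x ∈ S) : P x * P y = P (x * P y + P x * y) :=
    LinearMap.congr_fun (LinearMap.ext_on hS (f := LinearMap.mulLeft R (P x) ∘ₗ P)
      (g := P ∘ₗ (LinearMap.mulLeft R x ∘ₗ P + LinearMap.mulLeft R (P x))) (h x hx)) y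
  exact LinearMap.congr_fun (LinearMap.ext_on hS (f := LinearMap.mulRight R (P y) ∘ₗ P)
    (g := P ∘ₗ (LinearMap.mulRight R (P y) + LinearMap.mulRight R y ∘ₗ P))
    fun _ => linear_right) x

theorem opConj {R A : Type*} [CommSemiring R] [NonUnitalNonAssocSemiring A] [Module R A]
    {P : A →ₗ[R] A} (hP : IsRotaBaxterOperator P) :
    IsRotaBaxterOperator ((MulOpposite.opLinearEquiv R).conj P) := fun x y =>
  MulOpposite.unop_injective <| by simpa [add_comm] using hP y.unop x.unop

end IsRotaBaxterOperator

/-- The components of Rota-Baxter words: a letter (with head `false`) or a bracket (with head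
`true`). Treating both at once, the alternation of a word is the alternation of the heads of its
components. -/
inductive Component (X : Type u) : Bool → Type u
  | letter (x : X) : Component X false
  | bracket {h : Bool} (u : RBWord X h) : Component X true

namespace Component

variable {X : Type*} {h : Bool}

/-- A component as a word with one component. -/
def toWord : {h : Bool} → Component X h → RBWord X h
  | _, .letter x => .letter x
  | _, .bracket u => .bracket u

/-- The word with first component `p` and remaining components `w`. -/
def cons : {h : Bool} → (p : Component X h) → (w : RBWord X !h) → RBWord X h
  | _, .letter x, w => .letterCons x w
  | _, .bracket u, w => .bracketCons u w

end Component

section Words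

variable {K : Type*} [Field K] {B : Type*} [NonUnitalRing B] [Module K B] {X : Type*}
  (b : Module.Basis X K B) {h h' : Bool}

/-- The product of two components with the same head, as a combination of components. -/
def Component.mul : {h : Bool} → Component X h → Component X h → (Component X h →₀ K)
  | _, .letter x, .letter y => (b.repr (b x * b y)).mapDomain .letter
  | _, .bracket u, .bracket v =>
      (mulWord b (.bracket u) v).mapDomain .bracket + (mulWord b u (.bracket v)).mapDomain .bracket

theorem mulWord_cons (p : Component X h) (w : RBWord X !h) (y : RBWord X h') :
    mulWord b (p.cons w) y = (mulWord b w y).mapDomain p.cons := by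
  cases p <;> simp only [Component.cons, mulWord] <;> rfl

theorem mulWord_toWord (p : Component X h) (w : RBWord X !h) :
    mulWord b p.toWord w = .single (p.cons w) 1 := by
  cases p <;> cases w <;> simp [Component.toWord, Component.cons, mulWord]

theorem mulWord_toWord_toWord (p q : Component X h) :
    mulWord b p.toWord q.toWord = (p.mul b q).mapDomain Component.toWord := by
  cases p <;> cases q <;> simp only [Component.toWord, Component.mul, mulWord,
    Finsupp.mapDomain_add, ← Finsupp.mapDomain_comp] <;> rfl

theorem mulWord_toWord_cons (p q : Component X h) (w : RBWord X !h) :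
    mulWord b p.toWord (q.cons w) = (p.mul b q).mapDomain fun r => r.cons w := by
  cases p <;> cases q <;> simp only [Component.toWord, Component.cons, Component.mul, mulWord,
    Finsupp.mapDomain_add, ← Finsupp.mapDomain_comp] <;> rfl

namespace RBWordAlgebra

/-- A Rota-Baxter word as an element of the word algebra. -/
def word (w : RBWord X h) : RBWordAlgebra b := wordBasis b ⟨h, w⟩

/-- The span of the words with head `h`. -/
def headSpan (h : Bool) : Submodule K (RBWordAlgebra b) :=
  Submodule.span K (Set.range fun w : RBWord X h => word b w)

/-- The span of the words that consist of one component with head `h`. -/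
def componentSpan (h : Bool) : Submodule K (RBWordAlgebra b) :=
  Submodule.span K (Set.range fun p : Component X h => word b p.toWord)

variable {b}

theorem word_mem_headSpan (w : RBWord X h) : word b w ∈ headSpan b h :=
  Submodule.subset_span ⟨w, rfl⟩

theorem toWord_mem_componentSpan (p : Component X h) :
    word b p.toWord ∈ componentSpan b h :=
  Submodule.subset_span ⟨p, rfl⟩

theorem word_mul_word (x : RBWord X h) (y : RBWord X h') :
    word b x * word b y = Finsupp.linearCombination K (word b) (mulWord b x y) := by
  simp only [word, mul_def, mulLin, Module.Basis.constr_basis]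
  rfl

theorem word_cons (p : Component X h) (w : RBWord X !h) :
    word b (p.cons w) = word b p.toWord * word b w := by
  simp [word_mul_word, mulWord_toWord]

theorem word_cons_mul_word (p : Component X h) (w : RBWord X !h) (y : RBWord X h') :
    word b (p.cons w) * word b y = word b p.toWord * (word b w * word b y) := by
  rw [word_mul_word, word_mul_word, mulWord_cons, Finsupp.linearCombination_mapDomain,
    ← LinearMap.mulLeft_apply K, Finsupp.apply_linearCombination]
  exact congrArg (Finsupp.linearCombination K · _) (funext (word_cons p))

theorem toWord_mul_toWord (p q : Component X h) :
    word b p.toWord * word b q.toWord =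
      Finsupp.linearCombination K (fun r : Component X h => word b r.toWord) (p.mul b q) := by
  rw [word_mul_word, mulWord_toWord_toWord, Finsupp.linearCombination_mapDomain]
  rfl

theorem toWord_mul_cons (p q : Component X h) (w : RBWord X !h) :
    word b p.toWord * word b (q.cons w) = word b p.toWord * word b q.toWord * word b w := by
  rw [word_mul_word, toWord_mul_toWord, mulWord_toWord_cons, Finsupp.linearCombination_mapDomain,
    ← LinearMap.mulRight_apply K, Finsupp.apply_linearCombination]
  exact congrArg (Finsupp.linearCombination K · _) (funext fun r => word_cons r w)

theorem mul_mem_headSpan {t : RBWordAlgebra b} (ht : t ∈ headSpan b h) (m : RBWordAlgebra b) :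
    t * m ∈ headSpan b h := by
  refine mul_mem_of_mem_span ?_ ht ((wordBasis b).mem_span m)
  rintro _ ⟨x, rfl⟩ _ ⟨y, rfl⟩
  change word b x * word b y.2 ∈ _
  rw [word_mul_word, headSpan, ← Finsupp.range_linearCombination]
  exact LinearMap.mem_range_self _ _

theorem mul_mem_componentSpan {p q : RBWordAlgebra b} (hp : p ∈ componentSpan b h)
    (hq : q ∈ componentSpan b h) : p * q ∈ componentSpan b h := by
  refine mul_mem_of_mem_span ?_ hp hq
  rintro _ ⟨p, rfl⟩ _ ⟨q, rfl⟩
  rw [toWord_mul_toWord, componentSpan, ← Finsupp.range_linearCombination]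
  exact LinearMap.mem_range_self _ _

theorem mul_assoc_of_component_head {p t : RBWordAlgebra b} (hp : p ∈ componentSpan b h)
    (ht : t ∈ headSpan b !h) (m : RBWordAlgebra b) : p * t * m = p * (t * m) := by
  refine mul_assoc_of_mem_span ?_ hp ht ((wordBasis b).mem_span m)
  rintro _ ⟨p, rfl⟩ _ ⟨w, rfl⟩ _ ⟨y, rfl⟩
  exact (congrArg (· * word b y.2) (word_cons p w)).symm.trans (word_cons_mul_word p w y.2)

theorem mul_assoc_of_component_component_head {p q t : RBWordAlgebra b}
    (hp : p ∈ componentSpan b h) (hq : q ∈ componentSpan b h) (ht : t ∈ headSpan b !h) :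
    p * q * t = p * (q * t) := by
  refine mul_assoc_of_mem_span ?_ hp hq ht
  rintro _ ⟨p, rfl⟩ _ ⟨q, rfl⟩ _ ⟨w, rfl⟩
  exact (toWord_mul_cons p q w).symm.trans (congrArg (word b p.toWord * ·) (word_cons q w))

theorem incl_basis (x : X) : incl b (b x) = word b (.letter x) := by
  simp [incl, word]

theorem operator_word (u : RBWord X h) : operator b (word b u) = word b (.bracket u) := by
  simp [operator, word]

theorem isRotaBaxterOperator_operator : IsRotaBaxterOperator (operator b) := by
  refine .of_span_eq_top (wordBasis b).span_eq ?_
  rintro _ ⟨⟨h, u⟩, rfl⟩ _ ⟨⟨h', v⟩, rfl⟩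
  change operator b (word b u) * operator b (word b v) =
    operator b (word b u * operator b (word b v) + operator b (word b u) * word b v)
  simp only [operator_word, word_mul_word, mulWord, map_add, Finsupp.linearCombination_mapDomain,
    Finsupp.apply_linearCombination]
  rw [add_comm]
  congr 3 <;> exact funext fun w => (operator_word w).symm

@[elab_as_elim]
theorem generator_induction {motive : RBWordAlgebra b → Prop}
    (incl : ∀ a, motive (incl b a))
    (operator : ∀ m, motive m → motive (operator b m))
    (mul : ∀ m n, motive m → motive n → motive (m * n))
    (add : ∀ m n, motive m → motive n → motive (m + n))
    (smul : ∀ (c : K) m, motive m → motive (c • m)) (m : RBWordAlgebra b) : motive m := by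
  have letter (x : X) : motive (word b (.letter x)) := by rw [← incl_basis]; exact incl _
  have bracket {h : Bool} {u : RBWord X h} (ih : motive (word b u)) :
      motive (word b (.bracket u)) := by rw [← operator_word]; exact operator _ ih
  have cons {h : Bool} {p : Component X h} {w : RBWord X !h} (hp : motive (word b p.toWord))
      (hw : motive (word b w)) : motive (word b (p.cons w)) := by
    rw [word_cons]; exact mul _ _ hp hw
  have word_mem {h : Bool} (w : RBWord X h) : motive (word b w) := by
    induction w with
    | letter x => exact letter x
    | bracket u ih => exact bracket ih
    | letterCons x w ih => exact cons (p := .letter x) (letter x) ih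
    | bracketCons u w ihu ihw => exact cons (p := .bracket u) (bracket ihu) ihw
  induction (wordBasis b).mem_span m using Submodule.span_induction with
  | mem _ hw => obtain ⟨w, rfl⟩ := hw; exact word_mem w.2
  | zero => simpa only [map_zero] using incl 0
  | add m n _ _ hm hn => exact add m n hm hn
  | smul c m _ hm => exact smul c m hm

theorem word_cons_mul_assoc (p : Component X h) {w : RBWord X !h} {m n : RBWordAlgebra b}
    (hw : word b w * m * n = word b w * (m * n)) :
    word b (p.cons w) * m * n = word b (p.cons w) * (m * n) := by
  have hp := toWord_mem_componentSpan (b := b) p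
  have hwh := word_mem_headSpan (b := b) w
  rw [word_cons, mul_assoc_of_component_head hp hwh,
    mul_assoc_of_component_head hp (mul_mem_headSpan hwh m), hw, mul_assoc_of_component_head hp hwh]

theorem toWord_mul_cons_assoc (p q : Component X h) (w : RBWord X !h) (m : RBWordAlgebra b) :
    word b p.toWord * word b (q.cons w) * m = word b p.toWord * (word b (q.cons w) * m) := by
  have hp := toWord_mem_componentSpan (b := b) p
  have hq := toWord_mem_componentSpan (b := b) q
  have hw := word_mem_headSpan (b := b) w
  rw [toWord_mul_cons, word_cons, mul_assoc_of_component_head (mul_mem_componentSpan hp hq) hw,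
    mul_assoc_of_component_component_head hp hq (mul_mem_headSpan hw m),
    mul_assoc_of_component_head hq hw]

theorem toWord_mul_toWord_mul_cons_assoc {p q r : Component X h} (w : RBWord X !h)
    (hpqr : word b p.toWord * word b q.toWord * word b r.toWord =
      word b p.toWord * (word b q.toWord * word b r.toWord)) :
    word b p.toWord * word b q.toWord * word b (r.cons w) =
      word b p.toWord * (word b q.toWord * word b (r.cons w)) := by
  have hp := toWord_mem_componentSpan (b := b) p
  have hq := toWord_mem_componentSpan (b := b) q
  have hr := toWord_mem_componentSpan (b := b) r
  have hw := word_mem_headSpan (b := b) w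
  rw [word_cons, ← mul_assoc_of_component_component_head (mul_mem_componentSpan hp hq) hr hw, hpqr,
    mul_assoc_of_component_component_head hp (mul_mem_componentSpan hq hr) hw,
    mul_assoc_of_component_component_head hq hr hw]

theorem bracket_mul_assoc {u : RBWord X h}
    (hu : ∀ {h' h'' : Bool} (y : RBWord X h') (z : RBWord X h''),
      word b u * word b y * word b z = word b u * (word b y * word b z))
    {h' h'' : Bool} (y : RBWord X h') (z : RBWord X h'') :
    word b (.bracket u) * word b y * word b z = word b (.bracket u) * (word b y * word b z) := by
  have hp := toWord_mem_componentSpan (b := b) (.bracket u)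
  induction y generalizing h'' z with
  | letter y => exact mul_assoc_of_component_head hp (word_mem_headSpan (.letter y)) _
  | letterCons y w => exact mul_assoc_of_component_head hp (word_mem_headSpan (.letterCons y w)) _
  | bracketCons v w => exact toWord_mul_cons_assoc (.bracket u) (.bracket v) w _
  | bracket v ihv =>
    have hq := toWord_mem_componentSpan (b := b) (.bracket v)
    have bracket_bracket_bracket {h : Bool} {w : RBWord X h}
        (hw : word b (.bracket u) * word b (.bracket v) * word b w =
          word b (.bracket u) * (word b (.bracket v) * word b w)) :
        word b (.bracket u) * word b (.bracket v) * word b (.bracket w) =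
          word b (.bracket u) * (word b (.bracket v) * word b (.bracket w)) := by
      have hu := hu (.bracket v) (.bracket w)
      have hv := ihv (.bracket w)
      simp only [← operator_word] at hu hv hw ⊢
      exact isRotaBaxterOperator_operator.mul_mul_assoc hu hv hw
    induction z with
    | letter z => exact mul_assoc_of_component_component_head hp hq (word_mem_headSpan (.letter z))
    | letterCons z w =>
      exact mul_assoc_of_component_component_head hp hq (word_mem_headSpan (.letterCons z w))
    | bracket w ihw => exact bracket_bracket_bracket ihw
    | bracketCons w t ihw =>
      exact toWord_mul_toWord_mul_cons_assoc (p := .bracket u) (q := .bracket v) (r := .bracket w) t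
        (bracket_bracket_bracket ihw)

section Associativity

variable [IsScalarTower K B B] [SMulCommClass K B B]

theorem incl_mul (a c : B) : incl b (a * c) = incl b a * incl b c := by
  refine map_mul_of_mem_span (incl b) ?_ (b.mem_span a) (b.mem_span c)
  rintro _ ⟨x, rfl⟩ _ ⟨y, rfl⟩
  rw [incl_basis, incl_basis, word_mul_word, mulWord, Finsupp.linearCombination_mapDomain, incl,
    Module.Basis.constr_apply, Finsupp.linearCombination_apply]
  rfl

theorem letter_mul_assoc (x : X) {h' h'' : Bool} (y : RBWord X h') (z : RBWord X h'') :
    word b (.letter x) * word b y * word b z = word b (.letter x) * (word b y * word b z) := by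
  have letter_letter_letter (y z : X) :
      word b (.letter x) * word b (.letter y) * word b (.letter z) =
        word b (.letter x) * (word b (.letter y) * word b (.letter z)) := by
    simp only [← incl_basis, ← incl_mul, mul_assoc]
  have hp := toWord_mem_componentSpan (b := b) (.letter x)
  cases y with
  | bracket v => exact mul_assoc_of_component_head hp (word_mem_headSpan (.bracket v)) _
  | bracketCons v w => exact mul_assoc_of_component_head hp (word_mem_headSpan (.bracketCons v w)) _
  | letterCons y w => exact toWord_mul_cons_assoc (.letter x) (.letter y) w _
  | letter y =>
    have hq := toWord_mem_componentSpan (b := b) (.letter y)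
    cases z with
    | bracket w =>
      exact mul_assoc_of_component_component_head hp hq (word_mem_headSpan (.bracket w))
    | bracketCons w t =>
      exact mul_assoc_of_component_component_head hp hq (word_mem_headSpan (.bracketCons w t))
    | letter z => exact letter_letter_letter y z
    | letterCons z w =>
      exact toWord_mul_toWord_mul_cons_assoc (p := .letter x) (q := .letter y) (r := .letter z) w
        (letter_letter_letter y z)

theorem word_mul_assoc {h h' h'' : Bool} (x : RBWord X h) (y : RBWord X h') (z : RBWord X h'') :
    word b x * word b y * word b z = word b x * (word b y * word b z) := by
  induction x generalizing h' h'' y z with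
  | letter x => exact letter_mul_assoc x y z
  | bracket u ih => exact bracket_mul_assoc ih y z
  | letterCons x w ih => exact word_cons_mul_assoc (.letter x) (ih y z)
  | bracketCons u w _ ih => exact word_cons_mul_assoc (.bracket u) (ih y z)

instance : NonUnitalRing (RBWordAlgebra b) where
  mul_assoc l m n :=
    mul_assoc_of_mem_span
      (by rintro _ ⟨x, rfl⟩ _ ⟨y, rfl⟩ _ ⟨z, rfl⟩; exact word_mul_assoc x.2 y.2 z.2)
      ((wordBasis b).mem_span l) ((wordBasis b).mem_span m) ((wordBasis b).mem_span n)

end Associativity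

section Lift

variable {A : Type*} [NonUnitalNonAssocSemiring A] [Module K A]

variable (b) in
/-- The value on words of the extension of `g : B → A`, with brackets sent to values of `P`. -/
def liftWord (g : B →ₗ[K] A) (P : A →ₗ[K] A) : {h : Bool} → RBWord X h → A
  | _, .letter x => g (b x)
  | _, .bracket u => P (liftWord g P u)
  | _, .letterCons x w => g (b x) * liftWord g P w
  | _, .bracketCons u w => P (liftWord g P u) * liftWord g P w

variable (b) in
/-- The linear extension of `liftWord`, which is multiplicative as soon as `g` is and `P` is a
Rota-Baxter operator. -/
def liftLinear (g : B →ₗ[K] A) (P : A →ₗ[K] A) : RBWordAlgebra b →ₗ[K] A :=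
  (wordBasis b).constr K fun w => liftWord b g P w.2

variable {g : B →ₗ[K] A} {P : A →ₗ[K] A}

theorem liftLinear_word (w : RBWord X h) : liftLinear b g P (word b w) = liftWord b g P w := by
  simp [liftLinear, word]

theorem liftLinear_incl (a : B) : liftLinear b g P (incl b a) = g a := by
  refine LinearMap.congr_fun (b.ext (f₁ := liftLinear b g P ∘ₗ incl b) fun x => ?_) a
  rw [LinearMap.comp_apply, incl_basis, liftLinear_word, liftWord]

theorem liftLinear_operator (m : RBWordAlgebra b) :
    liftLinear b g P (operator b m) = P (liftLinear b g P m) := by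
  refine LinearMap.congr_fun ((wordBasis b).ext (f₁ := liftLinear b g P ∘ₗ operator b)
    (f₂ := P ∘ₗ liftLinear b g P) fun u => ?_) m
  change liftLinear b g P (operator b (word b u.2)) = P (liftLinear b g P (word b u.2))
  rw [operator_word, liftLinear_word, liftLinear_word, liftWord]

theorem liftLinear_word_cons (p : Component X h) (w : RBWord X !h) :
    liftLinear b g P (word b (p.cons w)) =
      liftLinear b g P (word b p.toWord) * liftLinear b g P (word b w) := by
  cases p <;> simp [liftLinear_word, Component.toWord, Component.cons, liftWord]

theorem liftLinear_mul_of_component_head [IsScalarTower K A A] [SMulCommClass K A A]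
    {p t : RBWordAlgebra b} (hp : p ∈ componentSpan b h) (ht : t ∈ headSpan b !h) :
    liftLinear b g P (p * t) = liftLinear b g P p * liftLinear b g P t := by
  refine map_mul_of_mem_span _ ?_ hp ht
  rintro _ ⟨p, rfl⟩ _ ⟨w, rfl⟩
  exact (congrArg (liftLinear b g P) (word_cons p w)).symm.trans (liftLinear_word_cons p w)

theorem hom_ext {P : A → A} {F G : RBWordAlgebra b →ₙₐ[K] A}
    (hF : ∀ m, F (operator b m) = P (F m)) (hG : ∀ m, G (operator b m) = P (G m))
    (h : ∀ a, F (incl b a) = G (incl b a)) : F = G := by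
  ext m
  induction m using generator_induction with
  | incl a => exact h a
  | operator m ih => rw [hF, hG, ih]
  | mul m n ihm ihn => rw [map_mul, map_mul, ihm, ihn]
  | add m n ihm ihn => rw [map_add, map_add, ihm, ihn]
  | smul c m ih => rw [map_smul, map_smul, ih]

end Lift

section Multiplicative

variable {A : Type*} [NonUnitalSemiring A] [Module K A] [IsScalarTower K A A] [SMulCommClass K A A]
  {g : B →ₗ[K] A} {P : A →ₗ[K] A}

theorem liftLinear_cons_mul (p : Component X h) {w : RBWord X !h} {m : RBWordAlgebra b}
    (hw : liftLinear b g P (word b w * m) = liftLinear b g P (word b w) * liftLinear b g P m) :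
    liftLinear b g P (word b (p.cons w) * m) =
      liftLinear b g P (word b (p.cons w)) * liftLinear b g P m := by
  have hp := toWord_mem_componentSpan (b := b) p
  have hwh := word_mem_headSpan (b := b) w
  rw [liftLinear_word_cons, word_cons, mul_assoc_of_component_head hp hwh,
    liftLinear_mul_of_component_head hp (mul_mem_headSpan hwh m), hw, mul_assoc]

theorem liftLinear_toWord_mul_cons {p q : Component X h} (w : RBWord X !h)
    (hpq : liftLinear b g P (word b p.toWord * word b q.toWord) =
      liftLinear b g P (word b p.toWord) * liftLinear b g P (word b q.toWord)) :
    liftLinear b g P (word b p.toWord * word b (q.cons w)) =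
      liftLinear b g P (word b p.toWord) * liftLinear b g P (word b (q.cons w)) := by
  have hp := toWord_mem_componentSpan (b := b) p
  have hq := toWord_mem_componentSpan (b := b) q
  rw [toWord_mul_cons, liftLinear_mul_of_component_head (mul_mem_componentSpan hp hq)
    (word_mem_headSpan w), hpq, liftLinear_word_cons, mul_assoc]

theorem liftLinear_bracket_mul (hP : IsRotaBaxterOperator P) {u : RBWord X h}
    (hu : ∀ {h' : Bool} (y : RBWord X h'), liftLinear b g P (word b u * word b y) =
      liftLinear b g P (word b u) * liftLinear b g P (word b y))
    {h' : Bool} (y : RBWord X h') :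
    liftLinear b g P (word b (.bracket u) * word b y) =
      liftLinear b g P (word b (.bracket u)) * liftLinear b g P (word b y) := by
  have hp := toWord_mem_componentSpan (b := b) (.bracket u)
  have bracket_bracket {h : Bool} {v : RBWord X h}
      (hv : liftLinear b g P (word b (.bracket u) * word b v) =
        liftLinear b g P (word b (.bracket u)) * liftLinear b g P (word b v)) :
      liftLinear b g P (word b (.bracket u) * word b (.bracket v)) =
        liftLinear b g P (word b (.bracket u)) * liftLinear b g P (word b (.bracket v)) := by
    have hu := hu (.bracket v)
    simp only [← operator_word, liftLinear_operator] at hu hv ⊢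
    rw [isRotaBaxterOperator_operator, liftLinear_operator, map_add, hu, hv, hP]
  induction y with
  | letter y => exact liftLinear_mul_of_component_head hp (word_mem_headSpan (.letter y))
  | letterCons y w =>
    exact liftLinear_mul_of_component_head hp (word_mem_headSpan (.letterCons y w))
  | bracket v ihv => exact bracket_bracket ihv
  | bracketCons v w ihv =>
    exact liftLinear_toWord_mul_cons (p := .bracket u) (q := .bracket v) w (bracket_bracket ihv)

variable [IsScalarTower K B B] [SMulCommClass K B B]

theorem liftLinear_letter_mul (hg : ∀ a c, g (a * c) = g a * g c) (x : X) (y : RBWord X h') :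
    liftLinear b g P (word b (.letter x) * word b y) =
      liftLinear b g P (word b (.letter x)) * liftLinear b g P (word b y) := by
  have hp := toWord_mem_componentSpan (b := b) (.letter x)
  have letter_letter (y : X) : liftLinear b g P (word b (.letter x) * word b (.letter y)) =
      liftLinear b g P (word b (.letter x)) * liftLinear b g P (word b (.letter y)) := by
    simp only [← incl_basis, ← incl_mul, liftLinear_incl, hg]
  cases y with
  | bracket v => exact liftLinear_mul_of_component_head hp (word_mem_headSpan (.bracket v))
  | bracketCons v w =>
    exact liftLinear_mul_of_component_head hp (word_mem_headSpan (.bracketCons v w))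
  | letter y => exact letter_letter y
  | letterCons y w =>
    exact liftLinear_toWord_mul_cons (p := .letter x) (q := .letter y) w (letter_letter y)

theorem liftLinear_word_mul_word (hg : ∀ a c, g (a * c) = g a * g c) (hP : IsRotaBaxterOperator P)
    {h h' : Bool} (x : RBWord X h) (y : RBWord X h') :
    liftLinear b g P (word b x * word b y) =
      liftLinear b g P (word b x) * liftLinear b g P (word b y) := by
  induction x generalizing h' y with
  | letter x => exact liftLinear_letter_mul hg x y
  | bracket u ih => exact liftLinear_bracket_mul hP ih y
  | letterCons x w ih => exact liftLinear_cons_mul (.letter x) (ih y)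
  | bracketCons u w _ ih => exact liftLinear_cons_mul (.bracket u) (ih y)

theorem liftLinear_mul (hg : ∀ a c, g (a * c) = g a * g c) (hP : IsRotaBaxterOperator P)
    (m n : RBWordAlgebra b) :
    liftLinear b g P (m * n) = liftLinear b g P m * liftLinear b g P n :=
  map_mul_of_mem_span _
    (by rintro _ ⟨x, rfl⟩ _ ⟨y, rfl⟩; exact liftLinear_word_mul_word hg hP x.2 y.2)
    ((wordBasis b).mem_span m) ((wordBasis b).mem_span n)

/-- The extension of an algebra map `g : B → A` to an algebra map on words that sends brackets to
values of the Rota-Baxter operator `P`. -/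
def liftHom (b : Module.Basis X K B) (g : B →ₙₐ[K] A) (hP : IsRotaBaxterOperator P) :
    RBWordAlgebra b →ₙₐ[K] A :=
  { liftLinear b (g : B →ₗ[K] A) P with
    map_zero' := map_zero _
    map_mul' := liftLinear_mul (map_mul g) hP }

theorem liftHom_incl (g : B →ₙₐ[K] A) (hP : IsRotaBaxterOperator P) (a : B) :
    liftHom b g hP (incl b a) = g a :=
  liftLinear_incl a

theorem liftHom_operator (g : B →ₙₐ[K] A) (hP : IsRotaBaxterOperator P)
    (m : RBWordAlgebra b) : liftHom b g hP (operator b m) = P (liftHom b g hP m) :=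
  liftLinear_operator m

end Multiplicative

section Involution

variable {σ : B →ₗ[K] B}

theorem star_incl (a : B) : star b σ (incl b a) = incl b (σ a) := by
  refine LinearMap.congr_fun (b.ext (f₁ := star b σ ∘ₗ incl b) (f₂ := incl b ∘ₗ σ) fun x => ?_) a
  simp [star, incl_basis, word, starWord]

theorem star_operator (m : RBWordAlgebra b) :
    star b σ (operator b m) = operator b (star b σ m) := by
  refine LinearMap.congr_fun ((wordBasis b).ext (f₁ := star b σ ∘ₗ operator b)
    (f₂ := operator b ∘ₗ star b σ) fun u => ?_) m
  simp [star, operator, starWord]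

open MulOpposite in
theorem op_star (m : RBWordAlgebra b) :
    op (star b σ m) = liftLinear b ((opLinearEquiv K).toLinearMap ∘ₗ incl b ∘ₗ σ)
      ((opLinearEquiv K).conj (operator b)) m := by
  refine LinearMap.congr_fun ((wordBasis b).ext (f₁ := (opLinearEquiv K).toLinearMap ∘ₗ star b σ)
    fun ⟨h, w⟩ => ?_) m
  simp only [star, liftLinear, LinearMap.comp_apply, Module.Basis.constr_basis]
  induction w with
  | letter x => simp [starWord, liftWord]
  | bracket u ih => simp [starWord, liftWord, ← ih]
  | letterCons x w ih => simp [starWord, liftWord, ← ih]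
  | bracketCons u w ihu ihw => simp [starWord, liftWord, ← ihu, ← ihw]

variable [IsScalarTower K B B] [SMulCommClass K B B]

theorem star_mul (hσ : ∀ a c, σ (a * c) = σ c * σ a) (m n : RBWordAlgebra b) :
    star b σ (m * n) = star b σ n * star b σ m := by
  refine MulOpposite.op_injective ?_
  rw [MulOpposite.op_mul, op_star, op_star, op_star]
  exact liftLinear_mul (fun a c => by simp [hσ, incl_mul]) isRotaBaxterOperator_operator.opConj m n

theorem star_star (hσ : ∀ a c, σ (a * c) = σ c * σ a) (hσσ : ∀ a, σ (σ a) = a)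
    (m : RBWordAlgebra b) : star b σ (star b σ m) = m := by
  induction m using generator_induction with
  | incl a => rw [star_incl, star_incl, hσσ]
  | operator m ih => rw [star_operator, star_operator, ih]
  | mul m n ihm ihn => rw [star_mul hσ, star_mul hσ, ihm, ihn]
  | add m n ihm ihn => rw [map_add, map_add, ihm, ihn]
  | smul c m ih => rw [map_smul, map_smul, ih]

theorem isInvolutiveRotaBaxter (hσ : ∀ a c, σ (a * c) = σ c * σ a) (hσσ : ∀ a, σ (σ a) = a) :
    IsInvolutiveRotaBaxter (star b σ) (operator b) where
  mul_assoc := mul_assoc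
  star_star := star_star hσ hσσ
  star_mul := star_mul hσ
  rota_baxter := isRotaBaxterOperator_operator
  map_star m := (star_operator m).symm

end Involution

section Universal

variable [IsScalarTower K B B] [SMulCommClass K B B] {σ : B →ₗ[K] B}

theorem map_star_of_map_star_incl {A : Type*} [NonUnitalNonAssocRing A] [Module K A]
    [IsScalarTower K A A] [SMulCommClass K A A] {starA R : A →ₗ[K] A}
    (hσ : ∀ a c, σ (a * c) = σ c * σ a)
    (hA : IsInvolutiveRotaBaxter starA R) {F : RBWordAlgebra b →ₙₐ[K] A}
    (hF : ∀ m, F (operator b m) = R (F m)) (h : ∀ a, F (incl b (σ a)) = starA (F (incl b a)))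
    (m : RBWordAlgebra b) : F (star b σ m) = starA (F m) := by
  induction m using generator_induction with
  | incl a => rw [star_incl, h]
  | operator m ih => rw [star_operator, hF, ih, hF, hA.map_star]
  | mul m n ihm ihn => rw [star_mul hσ, map_mul, ihm, ihn, map_mul, hA.star_mul]
  | add m n ihm ihn => simp only [map_add, ihm, ihn]
  | smul c m ih => simp only [map_smul, ih]

theorem existsUnique_hom {A : Type*} [NonUnitalRing A] [Module K A] [IsScalarTower K A A]
    [SMulCommClass K A A] {starA R : A →ₗ[K] A} (hσ : ∀ a c, σ (a * c) = σ c * σ a)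
    (hA : IsInvolutiveRotaBaxter starA R) (g : B →ₙₐ[K] A) (hg : ∀ a, g (σ a) = starA (g a)) :
    ∃! F : RBWordAlgebra b →ₙₐ[K] A,
      IsInvolutiveRotaBaxterHom (star b σ) (operator b) starA R F ∧ ∀ a, F (incl b a) = g a := by
  have hR : IsRotaBaxterOperator R := hA.rota_baxter
  have hop := liftHom_operator (b := b) g hR
  refine ⟨liftHom b g hR, ⟨⟨map_star_of_map_star_incl hσ hA hop fun a => ?_, hop⟩,
    liftHom_incl g hR⟩, fun G hG => hom_ext hG.1.map_operator hop fun a => ?_⟩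
  · rw [liftHom_incl, liftHom_incl, hg]
  · rw [hG.2, liftHom_incl]

end Universal

end RBWordAlgebra

end Words

section Tensor

variable {K : Type*} [Field K] {V : Type*} [AddCommGroup V] [Module K V]

theorem tensorPos_eq_adjoin :
    tensorPos K V = NonUnitalAlgebra.adjoin K (Set.range (TensorAlgebra.ι K)) := by
  refine le_antisymm ?_ (NonUnitalAlgebra.adjoin_le (Set.range_subset_iff.2 ι_mem_tensorPos))
  let T := NonUnitalAlgebra.adjoin K (Set.range (TensorAlgebra.ι K (M := V)))
  have range_le : LinearMap.range (TensorAlgebra.ι K) ≤ T.toSubmodule :=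
    NonUnitalAlgebra.subset_adjoin K
  refine iSup_le (a := T.toSubmodule) fun n => ?_
  induction n with
  | zero => simpa only [zero_add, pow_one] using range_le
  | succ n ih =>
    rw [pow_succ, Submodule.mul_le]
    exact fun x hx y hy => T.mul_mem (ih hx) (range_le hy)

@[elab_as_elim]
theorem tensorPos_induction {motive : tensorPos K V → Prop}
    (incl : ∀ v, motive (tensorIncl K v))
    (mul : ∀ x y, motive x → motive y → motive (x * y))
    (add : ∀ x y, motive x → motive y → motive (x + y))
    (smul : ∀ (c : K) x, motive x → motive (c • x)) (x : tensorPos K V) : motive x := by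
  suffices ∀ y ∈ NonUnitalAlgebra.adjoin K (Set.range (TensorAlgebra.ι K)),
      ∃ hy : y ∈ tensorPos K V, motive ⟨y, hy⟩ from (this x (tensorPos_eq_adjoin.le x.2)).2
  intro y hy
  induction hy using NonUnitalAlgebra.adjoin_induction with
  | mem _ hv => obtain ⟨v, rfl⟩ := hv; exact ⟨_, incl v⟩
  | zero =>
    have motive_zero : motive 0 := by simpa only [map_zero] using incl 0
    exact ⟨_, motive_zero⟩
  | add _ _ _ _ hx hy =>
    obtain ⟨_, hx⟩ := hx
    obtain ⟨_, hy⟩ := hy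
    exact ⟨_, add _ _ hx hy⟩
  | mul _ _ _ _ hx hy =>
    obtain ⟨_, hx⟩ := hx
    obtain ⟨_, hy⟩ := hy
    exact ⟨_, mul _ _ hx hy⟩
  | smul c _ _ hx => obtain ⟨_, hx⟩ := hx; exact ⟨_, smul c _ hx⟩

variable {σ : V →ₗ[K] V}

theorem tensorStar_tensorIncl (v : V) : tensorStar σ (tensorIncl K v) = tensorIncl K (σ v) :=
  Subtype.ext (tensorReverse_ι σ v)

theorem tensorStar_mul (x y : tensorPos K V) :
    tensorStar σ (x * y) = tensorStar σ y * tensorStar σ x :=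
  Subtype.ext (tensorReverse_mul σ x y)

theorem tensorStar_tensorStar (hσ : ∀ v, σ (σ v) = v) (x : tensorPos K V) :
    tensorStar σ (tensorStar σ x) = x := by
  induction x using tensorPos_induction with
  | incl v => rw [tensorStar_tensorIncl, tensorStar_tensorIncl, hσ]
  | mul x y hx hy => rw [tensorStar_mul, tensorStar_mul, hx, hy]
  | add x y hx hy => rw [map_add, map_add, hx, hy]
  | smul c x hx => rw [map_smul, map_smul, hx]

variable {A : Type*} [NonUnitalSemiring A] [Module K A] [IsScalarTower K A A] [SMulCommClass K A A]

/-- The extension of a linear map `f : V → A` to the unital tensor algebra, with values in the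
unitization of `A`. -/
def unitizationLift (f : V →ₗ[K] A) : TensorAlgebra K V →ₐ[K] Unitization K A :=
  TensorAlgebra.lift K (Unitization.inrHom K K A ∘ₗ f)

theorem unitizationLift_tensorIncl (f : V →ₗ[K] A) (v : V) :
    unitizationLift f (tensorIncl K v) = Unitization.inr (f v) :=
  TensorAlgebra.lift_ι_apply _ v

theorem fst_unitizationLift (f : V →ₗ[K] A) (x : tensorPos K V) :
    (unitizationLift f x).fst = 0 := by
  induction x using tensorPos_induction with
  | incl v => rw [unitizationLift_tensorIncl, Unitization.fst_inr]
  | mul x y hx _ => simp [hx]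
  | add x y hx hy => simp [hx, hy]
  | smul c x hx => simp [hx]

/-- The extension of a linear map `f : V → A` to the nonunitary tensor algebra. -/
def tensorLift (f : V →ₗ[K] A) : tensorPos K V →ₙₐ[K] A where
  toFun x := (unitizationLift f x).snd
  map_smul' c x := by simp
  map_zero' := by simp
  map_add' x y := by simp
  map_mul' x y := by simp [fst_unitizationLift]

theorem tensorLift_tensorIncl (f : V →ₗ[K] A) (v : V) : tensorLift f (tensorIncl K v) = f v :=
  congrArg (·.snd) (unitizationLift_tensorIncl f v)

theorem tensorLift_tensorStar {starA : A →ₗ[K] A} {f : V →ₗ[K] A}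
    (hA : ∀ x y, starA (x * y) = starA y * starA x) (hf : ∀ v, f (σ v) = starA (f v))
    (x : tensorPos K V) : tensorLift f (tensorStar σ x) = starA (tensorLift f x) := by
  induction x using tensorPos_induction with
  | incl v => rw [tensorStar_tensorIncl, tensorLift_tensorIncl, tensorLift_tensorIncl, hf]
  | mul x y hx hy => rw [tensorStar_mul, map_mul, hx, hy, map_mul, hA]
  | add x y hx hy => simp only [map_add, hx, hy]
  | smul c x hx => simp only [map_smul, hx]

theorem RBWordAlgebra.map_incl_eq_tensorLift_iff {X : Type*} {b : Module.Basis X K (tensorPos K V)}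
    {F : RBWordAlgebra b →ₙₐ[K] A} {f : V →ₗ[K] A} :
    (∀ x, F (incl b x) = tensorLift f x) ↔ ∀ v, F (incl b (tensorIncl K v)) = f v := by
  refine ⟨fun h v => by rw [h, tensorLift_tensorIncl], fun h x => ?_⟩
  induction x using tensorPos_induction with
  | incl v => rw [h, tensorLift_tensorIncl]
  | mul x y hx hy => rw [incl_mul, map_mul, hx, hy, map_mul]
  | add x y hx hy => simp only [map_add, hx, hy]
  | smul c x hx => simp only [map_smul, hx]

end Tensor

end RotaBaxter

end

theorem mainTheorem8_general {K : Type*} [Field K]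
    {V : Type*} [AddCommGroup V] [Module K V]
    (σ : V →ₗ[K] V) (hσ : ∀ v, σ (σ v) = v)
    {X : Type*} (b : Module.Basis X K (RotaBaxter.tensorPos K V)) :
    RotaBaxter.IsInvolutiveRotaBaxter
        (RotaBaxter.RBWordAlgebra.star b (RotaBaxter.tensorStar σ))
        (RotaBaxter.RBWordAlgebra.operator b) ∧
      (∀ v : V, RotaBaxter.RBWordAlgebra.incl b (RotaBaxter.tensorIncl K (σ v)) =
        RotaBaxter.RBWordAlgebra.star b (RotaBaxter.tensorStar σ)
          (RotaBaxter.RBWordAlgebra.incl b (RotaBaxter.tensorIncl K v))) ∧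
      ∀ (A : Type*) [NonUnitalRing A] [Module K A] [IsScalarTower K A A] [SMulCommClass K A A]
        (starA R : A →ₗ[K] A), RotaBaxter.IsInvolutiveRotaBaxter starA R →
        ∀ f : V →ₗ[K] A, (∀ v, f (σ v) = starA (f v)) →
          ∃! F : RotaBaxter.RBWordAlgebra b →ₙₐ[K] A,
            RotaBaxter.IsInvolutiveRotaBaxterHom
              (RotaBaxter.RBWordAlgebra.star b (RotaBaxter.tensorStar σ))
              (RotaBaxter.RBWordAlgebra.operator b) starA R F ∧
            ∀ v : V, F (RotaBaxter.RBWordAlgebra.incl b (RotaBaxter.tensorIncl K v)) = f v := by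
  have hmul := RotaBaxter.tensorStar_mul (σ := σ)
  refine ⟨RotaBaxter.RBWordAlgebra.isInvolutiveRotaBaxter hmul
    (RotaBaxter.tensorStar_tensorStar hσ), fun v => ?_, fun A _ _ _ _ starA R hA f hf => ?_⟩
  · rw [RotaBaxter.RBWordAlgebra.star_incl, RotaBaxter.tensorStar_tensorIncl]
  · simpa only [RotaBaxter.RBWordAlgebra.map_incl_eq_tensorLift_iff] using
      RotaBaxter.RBWordAlgebra.existsUnique_hom (b := b) hmul hA (RotaBaxter.tensorLift f)
        (RotaBaxter.tensorLift_tensorStar hA.star_mul hf)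

theorem mainTheorem8 {K : Type*} [Field K] [CharZero K]
    {V : Type*} [AddCommGroup V] [Module K V]
    (σ : V →ₗ[K] V) (hσ : ∀ v, σ (σ v) = v)
    {X : Type*} (b : Module.Basis X K (RotaBaxter.tensorPos K V)) :
    RotaBaxter.IsInvolutiveRotaBaxter
        (RotaBaxter.RBWordAlgebra.star b (RotaBaxter.tensorStar σ))
        (RotaBaxter.RBWordAlgebra.operator b) ∧
      (∀ v : V, RotaBaxter.RBWordAlgebra.incl b (RotaBaxter.tensorIncl K (σ v)) =
        RotaBaxter.RBWordAlgebra.star b (RotaBaxter.tensorStar σ)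
          (RotaBaxter.RBWordAlgebra.incl b (RotaBaxter.tensorIncl K v))) ∧
      ∀ (A : Type*) [NonUnitalRing A] [Module K A] [IsScalarTower K A A] [SMulCommClass K A A]
        (starA R : A →ₗ[K] A), RotaBaxter.IsInvolutiveRotaBaxter starA R →
        ∀ f : V →ₗ[K] A, (∀ v, f (σ v) = starA (f v)) →
          ∃! F : RotaBaxter.RBWordAlgebra b →ₙₐ[K] A,
            RotaBaxter.IsInvolutiveRotaBaxterHom
              (RotaBaxter.RBWordAlgebra.star b (RotaBaxter.tensorStar σ))
              (RotaBaxter.RBWordAlgebra.operator b) starA R F ∧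
            ∀ v : V, F (RotaBaxter.RBWordAlgebra.incl b (RotaBaxter.tensorIncl K v)) = f v :=
  mainTheorem8_general σ hσ b
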